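/- Let $0<q<1$, $x=\cos\theta$ with $\theta\in\mathbb R$, and let $a,b,c,d\in\mathbb C$ be real or occur in complex conjugate pairs, with $\max(|a|,|b|,|c|,|d|)<1$. Let $t\in\mathbb C$ with $|t|<(1-q)^3$, and let $\alpha\in\mathbb C\setminus\{0\}$ be a free parameter with $|\alpha t|<1$. Assume that no denominator below vanishes, i.e. $abcd\ne q$, $\alpha bcd\,q^{j-1}\neq 1$ and $\alpha b\,q^{j},\alpha c\,q^{j},\alpha d\,q^{j}\neq 1$ for all integers $j\ge 0$ (if $|\alpha|<1$ this only says $abcd\ne q\ne\alpha bcd$). Write $(a;q)_n=\prod_{j=0}^{n-1}(1-aq^j)$, $(a_1,\dots,a_r;q)_n=\prod_i (a_i;q)_n$, $${}_r\phi_s\!\left({a_1,\dots,a_r\atop b_1,\dots,b_s};q,z\right)=\sum_{k=0}^\infty\frac{(a_1,\dots,a_r;q)_k}{(q,b_1,\dots,b_s;q)_k}\Big((-1)^kq^{\binom k2}\Big)^{1+s-r}z^k,$$ and let $$p_n(x;\alpha,b,c,d|q)=\alpha^{-n}(\alpha b,\alpha c,\alpha d;q)_n\;{}_4\phi_3\!\left({q^{-n},\alpha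 bcdq^{n-1},\alpha e^{i\theta},\alpha e^{-i\theta}\atop \alpha b,\alpha c,\alpha d};q,q\right)$$ be the Askey–Wilson polynomials. Then $${}_2\phi_1\!\left({ae^{i\theta},be^{i\theta}\atop ab};q,te^{-i\theta}\right){}_2\phi_1\!\left({ce^{-i\theta},de^{-i\theta}\atop cd};q,te^{i\theta}\right)$$ $$=\sum_{n=0}^\infty\frac{t^n\,(\alpha bcd/q,\sqrt{abcd/q},-\sqrt{abcd/q},\sqrt{abcd},-\sqrt{abcd};q)_n}{(q,ab,cd,abcd/q,\sqrt{\alpha bcd/q},-\sqrt{\alpha bcd/q},\sqrt{\alpha bcd},-\sqrt{\alpha bcd};q)_n}\;{}_4\phi_3\!\left({a/\alpha,bcq^n,bdq^n,abcdq^{2n-1}\atop abq^n,abcdq^{n-1},\alpha bcdq^{2n}};q,\alpha t\right)p_n(x;\alpha,b,c,d|q),$$ all the series being absolutely convergent. -/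

import Mathlib

open scoped ComplexConjugate

noncomputable section

/-- The `q`-Pochhammer symbol `(a;q)_n = (1 - a)(1 - aq)⋯(1 - aq^{n-1})`. -/
def qPoch (a q : ℂ) (n : ℕ) : ℂ := ∏ j ∈ Finset.range n, (1 - a * q ^ j)

/-- The multi-parameter symbol `(a₁,…,a_r;q)_n = (a₁;q)_n ⋯ (a_r;q)_n`. -/
def qPochs (as : List ℂ) (q : ℂ) (n : ℕ) : ℂ := (as.map fun a => qPoch a q n).prod

/-- The `k`-th term of the basic hypergeometric series `_rφ_s(as; bs; q, z)`, where
`r = as.length` and `s = bs.length`. -/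
def basicHypTerm (as bs : List ℂ) (q z : ℂ) (k : ℕ) : ℂ :=
  qPochs as q k / qPochs (q :: bs) q k *
    ((-1) ^ k * q ^ k.choose 2) ^ (1 + (bs.length : ℤ) - (as.length : ℤ)) * z ^ k

/-- The basic hypergeometric series `_rφ_s(as; bs; q, z)`. -/
def basicHyp (as bs : List ℂ) (q z : ℂ) : ℂ := ∑' k : ℕ, basicHypTerm as bs q z k

/-- The Askey–Wilson polynomial `p_n(x; a, b, c, d | q)` at a point `x = cos θ` of `[-1, 1]`,
with `θ = arccos x`:
`a^{-n} (ab, ac, ad; q)_n ₄φ₃(q^{-n}, abcdq^{n-1}, ae^{iθ}, ae^{-iθ}; ab, ac, ad; q, q)`. -/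
def askeyWilson (n : ℕ) (x : ℝ) (a b c d q : ℂ) : ℂ :=
  (a ^ n)⁻¹ * qPochs [a * b, a * c, a * d] q n *
    basicHyp
      [q ^ (-(n : ℤ)), a * b * c * d * q ^ ((n : ℤ) - 1),
        a * Complex.exp (Complex.I * (Real.arccos x : ℝ)),
        a * Complex.exp (-(Complex.I * (Real.arccos x : ℝ)))]
      [a * b, a * c, a * d] q q

end

/-! ### Elementary identities for q-shifted factorials -/

section
open Finset Filter Topology

/-! Write `P_n(a)` for `awPoly q z a b c d n` with `z = e^{iθ}`. The Cauchy product of the two `₂φ₁`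
series has `t^n`-coefficient `P_n(a) / (q, ab, cd; q)_n`. Two applications of the q-Pfaff–Saalschütz
sum (`qSaalschutz`) expand `a^n P_n(a)` in the basis `(az, a/z; q)_k` (`pow_mul_awPoly`). The result
is the terminating `₄φ₃`, so `P_n` is the Askey–Wilson polynomial.

The theorem is then the connection formula `P_n(a) = ∑_{k+j=n} C_{k,j}(α) P_k(α)` (`sum_awConn`),
inserted into the generating function and summed over `j` first; the sum over `j` is the `₄φ₃` in
`αt` (`awConn_term`).

The connection formula is proved without orthogonality. A contiguous relation between `P_{n+1}(α)`,
`P_{n+1}(αq)` and `P_n(αq)` (`awPoly_contiguous`) shows that the right side `E(α)` satisfies `E(α) =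
E(αq)` (`sum_awConn_shift`). Since `αq^m → 0` and `E` is continuous at `0`, `E(α) = E(0) = E(a)`. At
`α = a` every coefficient with `j > 0` vanishes, hence `E(a) = P_n(a)`.

Summing by rows instead of diagonals is justified by absolute convergence: on `|z| = 1` the
polynomials grow at most linearly in `n`, and all q-shifted factorials involved are uniformly
bounded. -/

theorem qPoch_zero (a q : ℂ) : qPoch a q 0 = 1 := by simp [qPoch]

theorem qPoch_succ (a q : ℂ) (n : ℕ) : qPoch a q (n + 1) = qPoch a q n * (1 - a * q ^ n) := by
  simp [qPoch, prod_range_succ]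

theorem qPoch_add (a q : ℂ) (m n : ℕ) :
    qPoch a q (m + n) = qPoch a q m * qPoch (a * q ^ m) q n := by
  simp only [qPoch, prod_range_add, pow_add, mul_assoc]

theorem qPoch_succ' (a q : ℂ) (n : ℕ) : qPoch a q (n + 1) = (1 - a) * qPoch (a * q) q n := by
  rw [add_comm, qPoch_add, qPoch_succ, qPoch_zero]; simp

theorem qPoch_ne_zero {a q : ℂ} (h : ∀ j : ℕ, a * q ^ j ≠ 1) (n : ℕ) : qPoch a q n ≠ 0 :=
  prod_ne_zero_iff.2 fun j _ => sub_ne_zero.2 (h j).symm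

/-- The `q`-binomial coefficient `(q;q)_{i+j} / ((q;q)_i (q;q)_j)`. -/
noncomputable def qChoose (q : ℂ) (i j : ℕ) : ℂ := qPoch q q (i + j) / (qPoch q q i * qPoch q q j)

/-! ### The q-Pfaff–Saalschütz sum -/

section
variable {q : ℂ}

theorem qPoch_self_ne_zero (hq : ∀ n : ℕ, q ^ (n + 1) ≠ 1) (n : ℕ) : qPoch q q n ≠ 0 :=
  qPoch_ne_zero (fun j => by simpa [pow_succ'] using hq j) n

theorem qChoose_zero_right (hq : ∀ n : ℕ, q ^ (n + 1) ≠ 1) (i : ℕ) : qChoose q i 0 = 1 := by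
  simp [qChoose, qPoch_zero, qPoch_self_ne_zero hq]

theorem qChoose_zero_left (hq : ∀ n : ℕ, q ^ (n + 1) ≠ 1) (i : ℕ) : qChoose q 0 i = 1 := by
  simp [qChoose, qPoch_zero, qPoch_self_ne_zero hq]

theorem qChoose_comm (i j : ℕ) : qChoose q i j = qChoose q j i := by
  simp only [qChoose, add_comm i j, mul_comm (qPoch q q i)]

theorem qChoose_mul_qChoose (hq : ∀ n : ℕ, q ^ (n + 1) ≠ 1) (i m l : ℕ) :
    qChoose q i (m + l) * qChoose q m l = qChoose q (i + m) l * qChoose q i m := by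
  have h := qPoch_self_ne_zero hq
  have h1 := h i; have h2 := h m; have h3 := h l; have h4 := h (m + l); have h5 := h (i + m)
  simp only [qChoose, ← add_assoc]
  field_simp

/-- The product `∏_{s<n} (v - y q^s)`. -/
noncomputable def qProd (v y q : ℂ) (n : ℕ) : ℂ := ∏ s ∈ range n, (v - y * q ^ s)

theorem qProd_zero (v y : ℂ) : qProd v y q 0 = 1 := by simp [qProd]

theorem qProd_succ (v y : ℂ) (n : ℕ) :
    qProd v y q (n + 1) = qProd v y q n * (v - y * q ^ n) := by
  simp [qProd, prod_range_succ]

theorem qProd_mul (r v y : ℂ) (n : ℕ) : qProd (r * v) (r * y) q n = r ^ n * qProd v y q n := by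
  simp [qProd, mul_assoc, ← mul_sub, prod_mul_distrib]

theorem qProd_one (y : ℂ) (n : ℕ) : qProd 1 y q n = qPoch y q n := rfl

theorem qProd_eq_pow_mul (v y : ℂ) (n : ℕ) : qProd v (v * y) q n = v ^ n * qPoch y q n := by
  simpa [qProd_one] using qProd_mul (q := q) v 1 y n

/-- With `e = x q^{n-1}`, each factor is `e - q^s = -q^s (1 - x q^{n-1-s})`, so the product is a
q-shifted factorial read backwards. The hypothesis is multiplied by `q` to avoid the exponent `n -
1`. -/
theorem qProd_reverse (hq0 : q ≠ 0) (n : ℕ) (e x : ℂ) (h : e * q = x * q ^ n) :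
    qProd e 1 q n = (-1) ^ n * q ^ n.choose 2 * qPoch x q n := by
  induction n generalizing e with
  | zero => simp [qProd, qPoch]
  | succ n ih =>
    have he : e = x * q ^ n := mul_right_cancel₀ hq0 (by rw [h]; ring)
    have h1 : qProd e 1 q (n + 1) = (e - 1) * (q ^ n * qProd (e / q) 1 q n) := by
      rw [qProd, prod_range_succ', ← qProd_mul, mul_div_cancel₀ _ hq0, mul_comm]
      simp [qProd, pow_succ']
    rw [h1, ih (e / q) (by rw [div_mul_cancel₀ _ hq0, he]), qPoch_succ, he, Nat.choose_succ_succ]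
    simp
    ring

/-- The `q`-Pfaff–Saalschütz sum in polynomial form. -/
theorem qSaalschutz (hq : ∀ n : ℕ, q ^ (n + 1) ≠ 1) (v y e : ℂ) (k : ℕ) :
    ∑ p ∈ antidiagonal k, qChoose q p.1 p.2 * qProd v y q p.1 * qProd e 1 q p.1 *
      qPoch (e * v) q p.2 * qPoch (y * q ^ p.1) q p.2 = qPoch v q k * qPoch (y * e) q k := by
  set T : ℕ → ℕ → ℂ := fun i j => qChoose q i j * qProd v y q i * qProd e 1 q i *
      qPoch (e * v) q j * qPoch (y * q ^ i) q j with hT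
  have hn := qPoch_self_ne_zero hq
  -- Telescoping certificate: the partial sums for `k + 1` and `k` satisfy the recurrence of the
  -- right side up to one explicit boundary term. At `m = k` this boundary term is cancelled by the
  -- last summand `T (k + 1) 0`.
  have step : ∀ k m, m ≤ k → ∑ i ∈ range (m + 1), T i (k + 1 - i) =
      (1 - v * q ^ k) * (1 - y * e * q ^ k) * ∑ i ∈ range (m + 1), T i (k - i)
        - q ^ (k - m) * (v - y * q ^ m) * (e - q ^ m) * T m (k - m) := by
    intro k m
    induction m with
    | zero =>
      intro _
      simp only [zero_add, sum_range_one, hT, qProd_zero, Nat.sub_zero, qChoose_zero_left hq,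
        qPoch_succ]
      simp
      ring
    | succ m ih =>
      intro hm
      obtain ⟨j, rfl⟩ : ∃ j, k = m + 1 + j := ⟨k - (m + 1), by omega⟩
      rw [sum_range_succ, ih (by omega), sum_range_succ _ (m + 1)]
      have e1 : m + 1 + j + 1 - (m + 1) = j + 1 := by omega
      have e2 : m + 1 + j - (m + 1) = j := by omega
      have e3 : m + 1 + j - m = j + 1 := by omega
      rw [e1, e2, e3]
      have key : T (m + 1) (j + 1) =
        (1 - v * q ^ (m + 1 + j)) * (1 - y * e * q ^ (m + 1 + j)) * T (m + 1) j
        - q ^ j * (v - y * q ^ (m + 1)) * (e - q ^ (m + 1)) * T (m + 1) j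
        + q ^ (j + 1) * (v - y * q ^ m) * (e - q ^ m) * T m (j + 1) := by
        have h1 := hn m; have h2 := hn j; have h3 := hn (m + j)
        have h4 : 1 - q ^ (m + 1) ≠ 0 := sub_ne_zero.2 (hq m).symm
        have h5 : 1 - q ^ (j + 1) ≠ 0 := sub_ne_zero.2 (hq j).symm
        have p1 : m + 1 + (j + 1) = (m + j) + 1 + 1 := by omega
        have p2 : m + 1 + j = m + j + 1 := by omega
        have p3 : m + (j + 1) = m + j + 1 := by omega
        have hp : qPoch (y * q ^ m) q (j + 1) = (1 - y * q ^ m) * qPoch (y * q ^ (m + 1)) q j := by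
          rw [qPoch_succ', pow_succ, mul_assoc]
        simp only [hT, qChoose, p1, p2, p3, hp]
        simp only [qPoch_succ, qProd_succ, pow_succ', ← mul_assoc] at *
        simp only [pow_add] at *
        generalize q ^ m = u at *
        generalize q ^ j = w at *
        field_simp
        ring
      rw [key]; ring
  have main : ∀ k, ∑ i ∈ range (k + 1), T i (k - i) = qPoch v q k * qPoch (y * e) q k := by
    intro k
    induction k with
    | zero => simp [hT, qProd_zero, qPoch_zero, qChoose_zero_left hq]
    | succ k ih =>
      rw [sum_range_succ, step k k le_rfl, ih, qPoch_succ, qPoch_succ]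
      simp only [Nat.sub_self, hT, qPoch_zero, qChoose_zero_right hq, qProd_succ]
      ring
  rw [Finset.Nat.sum_antidiagonal_eq_sum_range_succ_mk]
  exact main k
end

theorem sum_antidiagonal_assoc (f : ℕ → ℕ → ℕ → ℂ) (n : ℕ) :
    ∑ p ∈ antidiagonal n, ∑ r ∈ antidiagonal p.2, f p.1 r.1 r.2 =
      ∑ p ∈ antidiagonal n, ∑ r ∈ antidiagonal p.1, f r.1 r.2 p.2 := by
  rw [sum_sigma', sum_sigma']
  refine sum_nbij' (fun x => ⟨(x.1.1 + x.2.1, x.2.2), (x.1.1, x.2.1)⟩)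
    (fun x => ⟨(x.2.1, x.2.2 + x.1.2), (x.2.2, x.1.2)⟩) ?_ ?_ ?_ ?_ ?_ <;>
  rintro ⟨⟨i, j⟩, ⟨k, l⟩⟩ h <;> simp only [mem_sigma, HasAntidiagonal.mem_antidiagonal] at h ⊢ <;>
  obtain ⟨rfl, rfl⟩ := h <;> simp [add_assoc]

theorem choose_two_add_self (n : ℕ) : n.choose 2 + n.choose 2 + n = n * n := by
  induction n with
  | zero => rfl
  | succ n ih => rw [Nat.choose_succ_succ, Nat.choose_one_right]; linarith

theorem choose_two_add (i m : ℕ) :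
    (i + m).choose 2 = i.choose 2 + m.choose 2 + i * m := by
  induction m with
  | zero => simp
  | succ m ih =>
    rw [← add_assoc, Nat.choose_succ_succ, Nat.choose_succ_succ, ih]
    simp; ring

/-! ### The Askey–Wilson polynomial as a coefficient and as a `₄φ₃` -/

section
variable {q : ℂ}

/-- Expansion of `(c, d; q)_N` in the basis `(A; q)_m`. -/
theorem pow_mul_qPoch_mul_qPoch (hq0 : q ≠ 0) (hq : ∀ n : ℕ, q ^ (n + 1) ≠ 1) {A : ℂ}
    (hA : A ≠ 0) (c d B : ℂ) (N : ℕ) (hB : B * q = A * c * d * q ^ N) :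
    A ^ N * (qPoch c q N * qPoch d q N) =
      ∑ p ∈ antidiagonal N, qChoose q p.1 p.2 * ((-1) ^ p.1 / (q ^ p.1.choose 2 * q ^ (p.1 * p.2))) *
        qPoch A q p.1 * qPoch B q p.1 * qPoch (A * c * q ^ p.1) q p.2 *
        qPoch (A * d * q ^ p.1) q p.2 := by
  -- The choice gives `ye = d` and `ev = B`. The three remaining products become factorials in `Ad`,
  -- `Ac` and `A` once reversed.
  have h := qSaalschutz hq c (q / (A * q ^ N)) (A * d * q ^ N / q) N
  have h1 : q / (A * q ^ N) * (A * d * q ^ N / q) = d := by field_simp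
  have h2 : A * d * q ^ N / q * c = B := by
    rw [div_mul_eq_mul_div, div_eq_iff hq0, hB]; ring
  rw [h1, h2] at h
  rw [← h, ← Nat.sum_antidiagonal_swap, mul_sum]
  refine sum_congr rfl fun p hp => ?_
  obtain ⟨m, j⟩ := p
  obtain rfl : m + j = N := by simpa using hp
  simp only [Prod.swap]
  have r1 : qProd (A * d * q ^ (m + j) / q) 1 q j =
      (-1) ^ j * q ^ j.choose 2 * qPoch (A * d * q ^ m) q j :=
    qProd_reverse hq0 j _ _ (by rw [div_mul_cancel₀ _ hq0]; ring)
  have r2 : qProd c (q / (A * q ^ (m + j))) q j = (q / (A * q ^ (m + j))) ^ j *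
      ((-1) ^ j * q ^ j.choose 2 * qPoch (A * c * q ^ m) q j) := by
    rw [← qProd_reverse hq0 j (c * A * q ^ (m + j) / q) _
      (by rw [div_mul_cancel₀ _ hq0]; ring), ← qProd_mul]
    congr 1 <;> field_simp
  have r3 : qPoch (q / (A * q ^ (m + j)) * q ^ j) q m = (q / (A * q ^ m)) ^ m *
      ((-1) ^ m * q ^ m.choose 2 * qPoch A q m) := by
    rw [← qProd_reverse hq0 m (A * q ^ m / q) _
      (by rw [div_mul_cancel₀ _ hq0]), ← qProd_mul, ← qProd_one]
    congr 1 <;> field_simp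
    ring
  have key : A ^ (m + j) * ((q / (A * q ^ (m + j))) ^ j * ((-1) ^ j * q ^ j.choose 2) *
      ((-1) ^ j * q ^ j.choose 2) * ((q / (A * q ^ m)) ^ m * ((-1) ^ m * q ^ m.choose 2))) =
      (-1) ^ m / (q ^ m.choose 2 * q ^ (m * j)) := by
    have tri : ∀ n : ℕ, q ^ n.choose 2 * q ^ n.choose 2 * q ^ n = q ^ (n * n) := fun n => by
      rw [← pow_add, ← pow_add, choose_two_add_self]
    have t1 := tri j
    have t2 := tri m
    have sg : (-1 : ℂ) ^ j * (-1) ^ j = 1 := by rw [← mul_pow]; simp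
    rw [div_pow, div_pow, mul_pow, mul_pow, ← pow_mul, ← pow_mul, add_mul, pow_add q (m * j), ← t1,
      ← t2, pow_add]
    have a1 : q ^ j.choose 2 ≠ 0 := pow_ne_zero _ hq0
    have a2 : q ^ m.choose 2 ≠ 0 := pow_ne_zero _ hq0
    have a3 : q ^ (m * j) ≠ 0 := pow_ne_zero _ hq0
    field_simp
    linear_combination sg
  rw [r1, r2, r3, qChoose_comm, ← key]
  ring

/-- The Askey–Wilson polynomial as a polynomial in its parameters; up to the factor
`(q, ab, cd; q)_n`, the coefficient of `t^n` in the product of two `₂φ₁` series. -/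
noncomputable def awPoly (q z a b c d : ℂ) (n : ℕ) : ℂ :=
  ∑ p ∈ antidiagonal n, qChoose q p.1 p.2 *
    (qPoch (a * z) q p.1 * qPoch (b * z) q p.1 * qPoch (a * b * q ^ p.1) q p.2 * z⁻¹ ^ p.1) *
    (qPoch (c * z⁻¹) q p.2 * qPoch (d * z⁻¹) q p.2 * qPoch (c * d * q ^ p.2) q p.1 * z ^ p.2)

theorem awPoly_comm (z a b c d : ℂ) (n : ℕ) : awPoly q z a b c d n = awPoly q z b a c d n := by
  refine sum_congr rfl fun p _ => ?_
  rw [mul_comm a b]; ring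

/-- The `k`-th coefficient of the Askey–Wilson polynomial in the basis `(az, a/z; q)_k`,
where `n = k + l` and `F = abcd / q`. -/
noncomputable def awCoeff (q a b c d F : ℂ) (k l : ℕ) : ℂ :=
  qChoose q k l * ((-1) ^ k / (q ^ k.choose 2 * q ^ (k * l))) *
    (qPoch (F * q ^ (k + l)) q k * qPoch (a * b * q ^ k) q l * qPoch (a * c * q ^ k) q l *
      qPoch (a * d * q ^ k) q l)

/-- Expanding `(c/z, d/z; q)_j` in the basis `(azq^i; q)_m` makes `(az; q)_i` grow to `(az;
q)_{i+m}`. For fixed `k = i + m` the inner sum is again of Saalschütz type and produces `(a/z;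
q)_k`. The resulting form is symmetric in `b, c, d`, which the definition is not. -/
theorem pow_mul_awPoly (hq0 : q ≠ 0) (hq : ∀ n : ℕ, q ^ (n + 1) ≠ 1) {z a : ℂ} (hz : z ≠ 0)
    (ha : a ≠ 0) (b c d F : ℂ) (hF : F * q = a * b * c * d) (n : ℕ) :
    a ^ n * awPoly q z a b c d n = ∑ p ∈ antidiagonal n, awCoeff q a b c d F p.1 p.2 *
      (qPoch (a * z) q p.1 * qPoch (a * z⁻¹) q p.1) := by
  -- This `e` lets `(cdq^j; q)_i` be reversed into `∏ (e - q^s)` and satisfies `abe = Fq^n`, as the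
  -- second Saalschütz sum needs.
  set e : ℂ := c * d * q ^ n / q with he
  have heq : e * q = c * d * q ^ n := by rw [he, div_mul_cancel₀ _ hq0]
  have hbe : a * b * e = F * q ^ n := mul_right_cancel₀ hq0 (by
    linear_combination a * b * heq - q ^ n * hF)
  set f : ℕ → ℕ → ℕ → ℂ := fun i m l => qChoose q (i + m) l * qChoose q i m *
      ((-1) ^ (i + m) / (q ^ (i + m).choose 2 * q ^ ((i + m) * l))) * qPoch (a * z) q (i + m) *
      (qProd (a * z⁻¹) (a * b) q i * qProd e 1 q i * qPoch (e * (a * z⁻¹)) q m *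
        qPoch (a * b * q ^ i) q m) * (qPoch (a * b * q ^ (i + m)) q l *
      qPoch (a * c * q ^ (i + m)) q l * qPoch (a * d * q ^ (i + m)) q l) with hf
  have h1 : a ^ n * awPoly q z a b c d n =
      ∑ p ∈ antidiagonal n, ∑ r ∈ antidiagonal p.2, f p.1 r.1 r.2 := by
    rw [awPoly, mul_sum]
    refine sum_congr rfl fun p hp => ?_
    obtain ⟨i, j⟩ := p
    obtain rfl : i + j = n := by simpa using hp
    simp only
    have hA : a * z * q ^ i ≠ 0 := mul_ne_zero (mul_ne_zero ha hz) (pow_ne_zero _ hq0)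
    have hB : e * (a * z⁻¹) * q = a * z * q ^ i * (c * z⁻¹) * (d * z⁻¹) * q ^ j := by
      rw [mul_right_comm, heq, pow_add]; field_simp
    have hs := pow_mul_qPoch_mul_qPoch hq0 hq hA (c * z⁻¹) (d * z⁻¹) _ j hB
    have hs' : a ^ j * (qPoch (c * z⁻¹) q j * qPoch (d * z⁻¹) q j * z ^ j) =
        (q ^ (i * j))⁻¹ * ((a * z * q ^ i) ^ j * (qPoch (c * z⁻¹) q j * qPoch (d * z⁻¹) q j)) := by
      rw [mul_pow, mul_pow, ← pow_mul]
      have := pow_ne_zero (i * j) hq0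
      field_simp
    have hr : (-1) ^ i * q ^ i.choose 2 * qPoch (c * d * q ^ j) q i = qProd e 1 q i :=
      (qProd_reverse hq0 i _ _ (by rw [heq]; ring)).symm
    have hv : qProd (a * z⁻¹) (a * b) q i = a ^ i * z⁻¹ ^ i * qPoch (b * z) q i := by
      rw [← mul_pow, ← qProd_eq_pow_mul]; congr 1; field_simp
    calc _ = qChoose q i j * (qPoch (a * z) q i * (a ^ i * z⁻¹ ^ i * qPoch (b * z) q i) *
            qPoch (a * b * q ^ i) q j) * qPoch (c * d * q ^ j) q i *
            (a ^ j * (qPoch (c * z⁻¹) q j * qPoch (d * z⁻¹) q j * z ^ j)) := by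
          rw [pow_add]; ring
      _ = _ := by
          rw [hs', hs, ← hv, mul_sum, mul_sum]
          refine sum_congr rfl fun r hr' => ?_
          obtain ⟨m, l⟩ := r
          obtain rfl : m + l = j := by simpa using hr'
          simp only [hf, ← hr]
          have c1 := qChoose_mul_qChoose hq i m l
          rw [← c1, qPoch_add (a * z), qPoch_add _ _ m l]
          have z1 : a * z * q ^ i * (c * z⁻¹) * q ^ m = a * c * q ^ (i + m) := by
            rw [pow_add]; field_simp
          have z2 : a * z * q ^ i * (d * z⁻¹) * q ^ m = a * d * q ^ (i + m) := by
            rw [pow_add]; field_simp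
          have z3 : a * b * q ^ i * q ^ m = a * b * q ^ (i + m) := by rw [pow_add]; ring
          rw [z1, z2, z3]
          have w : (-1 : ℂ) ^ (i + m) / (q ^ (i + m).choose 2 * q ^ ((i + m) * l)) *
              ((-1) ^ i * q ^ i.choose 2) =
              (q ^ (i * (m + l)))⁻¹ * ((-1) ^ m / (q ^ m.choose 2 * q ^ (m * l))) := by
            have sg : (-1 : ℂ) ^ i * (-1) ^ i = 1 := by rw [← mul_pow]; simp
            rw [choose_two_add]
            simp only [pow_add, add_mul, mul_add]
            have a1 : q ^ i.choose 2 ≠ 0 := pow_ne_zero _ hq0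
            field_simp
            linear_combination sg
          linear_combination (-(qChoose q i (m + l) * qChoose q m l * qPoch (a * z) q i *
            qPoch (a * z * q ^ i) q m * qProd (a * z⁻¹) (a * b) q i *
            qPoch (c * d * q ^ (m + l)) q i * qPoch (e * (a * z⁻¹)) q m *
            qPoch (a * b * q ^ i) q m * qPoch (a * b * q ^ (i + m)) q l *
            qPoch (a * c * q ^ (i + m)) q l * qPoch (a * d * q ^ (i + m)) q l)) * w
  -- Regroup the triple sum from `i + (m + l)` to `(i + m) + l`.
  rw [h1, sum_antidiagonal_assoc]
  refine sum_congr rfl fun p hp => ?_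
  obtain ⟨k, l⟩ := p
  obtain rfl : k + l = n := by simpa using hp
  have hs := qSaalschutz hq (a * z⁻¹) (a * b) e k
  rw [hbe] at hs
  calc _ = ∑ r ∈ antidiagonal k, qChoose q k l *
        ((-1) ^ k / (q ^ k.choose 2 * q ^ (k * l))) * qPoch (a * z) q k *
        (qPoch (a * b * q ^ k) q l * qPoch (a * c * q ^ k) q l * qPoch (a * d * q ^ k) q l) *
        (qChoose q r.1 r.2 * qProd (a * z⁻¹) (a * b) q r.1 * qProd e 1 q r.1 *
          qPoch (e * (a * z⁻¹)) q r.2 * qPoch (a * b * q ^ r.1) q r.2) := by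
        refine sum_congr rfl fun r hr => ?_
        obtain ⟨i, m⟩ := r
        obtain rfl : i + m = k := by simpa using hr
        simp only [hf]; ring
    _ = _ := by rw [← mul_sum, hs, awCoeff]; ring
end

/-! ### Contiguous relation and connection formula in one parameter -/

section
variable {q : ℂ}

theorem continuous_awPoly {f g : ℂ → ℂ} (hf : Continuous f) (hg : Continuous g) (z c d : ℂ)
    (n : ℕ) : Continuous fun x => awPoly q z (f x) (g x) c d n := by
  unfold awPoly qPoch; fun_prop

theorem qPoch_mul_shift (x : ℂ) (m n : ℕ) :
    (1 - x * q ^ m) * qPoch (x * q ^ (m + 1)) q n =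
      qPoch (x * q ^ m) q n * (1 - x * q ^ (m + n)) := by
  rw [pow_succ, ← mul_assoc, ← qPoch_succ', qPoch_succ, mul_assoc x, ← pow_add]

theorem qChoose_succ_right (hq : ∀ n : ℕ, q ^ (n + 1) ≠ 1) (k l : ℕ) :
    qChoose q k (l + 1) * (1 - q ^ (l + 1)) = qChoose q k l * (1 - q ^ (k + l + 1)) := by
  have h1 := qPoch_self_ne_zero hq k
  have h2 := qPoch_self_ne_zero hq l
  have h3 : 1 - q ^ (l + 1) ≠ 0 := sub_ne_zero.2 (hq l).symm
  simp only [qChoose, ← add_assoc, qPoch_succ, ← pow_succ']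
  field_simp

/-- Contiguous relation between Askey–Wilson polynomials with parameters `α` and `αq`. -/
theorem awPoly_contiguous (hq0 : q ≠ 0) (hq : ∀ n : ℕ, q ^ (n + 1) ≠ 1) {z : ℂ} (hz : z ≠ 0)
    (α b c d : ℂ) (n : ℕ) :
    (1 - α * b * c * d / q * q ^ (2 * n + 2)) * awPoly q z α b c d (n + 1) =
      (1 - α * b * c * d / q * q ^ (n + 1)) * awPoly q z (α * q) b c d (n + 1) -
        α * (1 - q ^ (n + 1)) * (1 - b * c * q ^ n) * (1 - b * d * q ^ n) * (1 - c * d * q ^ n) *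
          awPoly q z (α * q) b c d n := by
  refine congrFun (f := fun b => (1 - α * b * c * d / q * q ^ (2 * n + 2)) *
    awPoly q z α b c d (n + 1)) (g := fun b => (1 - α * b * c * d / q * q ^ (n + 1)) *
    awPoly q z (α * q) b c d (n + 1) - α * (1 - q ^ (n + 1)) * (1 - b * c * q ^ n) *
    (1 - b * d * q ^ n) * (1 - c * d * q ^ n) * awPoly q z (α * q) b c d n) ?_ b
  have c1 := continuous_awPoly (q := q) (continuous_const (y := α)) continuous_id z c d (n + 1)
  have c2 := continuous_awPoly (q := q) (continuous_const (y := α * q)) continuous_id z c d (n + 1)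
  have c3 := continuous_awPoly (q := q) (continuous_const (y := α * q)) continuous_id z c d n
  simp only [id] at c1 c2 c3
  -- The expansion below cancels `b^(n+1)`, so it needs `b ≠ 0`; both sides are continuous in `b`,
  -- which covers `b = 0`.
  refine Continuous.ext_on (dense_compl_singleton (0 : ℂ)) (by fun_prop) (by fun_prop) ?_
  intro b hb
  have hb : b ≠ 0 := hb
  simp only
  obtain ⟨F, hF⟩ : ∃ F, F = α * b * c * d / q := ⟨_, rfl⟩
  have hFq : F * q = b * α * c * d := by rw [hF, div_mul_cancel₀ _ hq0]; ring
  have hFq' : F * q * q = b * (α * q) * c * d := by rw [hFq]; ring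
  have e1 := pow_mul_awPoly hq0 hq hz hb α c d F hFq (n + 1)
  have e2 := pow_mul_awPoly hq0 hq hz hb (α * q) c d (F * q) hFq' (n + 1)
  have e3 := pow_mul_awPoly hq0 hq hz hb (α * q) c d (F * q) hFq' n
  rw [← hF]
  apply mul_left_cancel₀ (pow_ne_zero (n + 1) hb)
  -- With `b` as base parameter, the basis `(bz, b/z; q)_k` does not involve `α`, so the relation
  -- can be checked coefficientwise: `s0` for `k = n + 1`, `s1` for `k ≤ n`.
  rw [awPoly_comm z α, awPoly_comm z (α * q), awPoly_comm z (α * q)]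
  have s0 : awCoeff q b α c d F (n + 1) 0 * (1 - F * q ^ (2 * n + 2)) =
      (1 - F * q ^ (n + 1)) * awCoeff q b (α * q) c d (F * q) (n + 1) 0 := by
    have := qPoch_mul_shift (q := q) F (n + 1) (n + 1)
    simp only [awCoeff, qPoch_zero, add_zero, mul_assoc F q, ← pow_succ']
    rw [show n + 1 + (n + 1) = 2 * n + 2 by ring] at this
    linear_combination (-(qChoose q (n + 1) 0 *
      ((-1) ^ (n + 1) / (q ^ (n + 1).choose 2 * q ^ ((n + 1) * 0))))) * this
  have s1 : ∀ k l, k + l = n → awCoeff q b α c d F k (l + 1) * (1 - F * q ^ (2 * n + 2)) =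
      (1 - F * q ^ (n + 1)) * awCoeff q b (α * q) c d (F * q) k (l + 1) -
      α * b * (1 - q ^ (n + 1)) * (1 - b * c * q ^ n) * (1 - b * d * q ^ n) * (1 - c * d * q ^ n) *
        awCoeff q b (α * q) c d (F * q) k l := by
    rintro k l rfl
    have h1 := qPoch_mul_shift (q := q) F (k + l + 1) k
    have h2 := qChoose_succ_right hq k l
    have h4 : qPoch (b * α * q ^ k) q (l + 1) =
      (1 - b * α * q ^ k) * qPoch (b * α * q ^ (k + 1)) q l := by
      rw [qPoch_succ', mul_assoc _ (q ^ k), ← pow_succ]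
    have h5 : b * (α * q) * q ^ k = b * α * q ^ (k + 1) := by rw [pow_succ']; ring
    have h6 : q ^ (k * (l + 1)) = q ^ (k * l) * q ^ k := by rw [mul_add, pow_add, mul_one]
    simp only [awCoeff, ← add_assoc, h4, h5, mul_assoc F q, ← pow_succ', h6]
    simp only [qPoch_succ, mul_assoc (b * c) (q ^ k), mul_assoc (b * d) (q ^ k),
      mul_assoc (b * α) (q ^ (k + 1)), ← pow_add q k l, ← pow_add q (k + 1) l]
    set w := (-1 : ℂ) ^ k / (q ^ k.choose 2 * q ^ (k * l)) with hw
    have hw' : (-1 : ℂ) ^ k / (q ^ k.choose 2 * (q ^ (k * l) * q ^ k)) = w / q ^ k := by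
      rw [hw, ← mul_assoc, div_div]
    rw [hw']
    have hk : q ^ k ≠ 0 := pow_ne_zero _ hq0
    have hd : w = w / q ^ k * q ^ k := by field_simp
    generalize w / q ^ k = v at hd
    rw [hd]
    have p1 : k + 1 + l = k + l + 1 := by ring
    rw [p1]
    set Z := qPoch (b * α * q ^ (k + 1)) q l * qPoch (b * c * q ^ k) q l *
      qPoch (b * d * q ^ k) q l * v * (1 - b * c * q ^ (k + l)) * (1 - b * d * q ^ (k + l))
    linear_combination (-(Z * qChoose q k (l + 1) * (1 - b * α * q ^ (k + l + 1)))) * h1 -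
      α * b * Z * (1 - c * d * q ^ (k + l)) * q ^ k * qPoch (F * q ^ (k + l + 1)) q k * h2 -
      Z * qChoose q k (l + 1) * qPoch (F * q ^ (k + l + 1)) q k *
        (q ^ (2 * (k + l) + 1) - q ^ (k + l + k)) * hFq
  have key : b ^ (n + 1) * awPoly q z b α c d (n + 1) * (1 - F * q ^ (2 * n + 2)) =
      (1 - F * q ^ (n + 1)) * (b ^ (n + 1) * awPoly q z b (α * q) c d (n + 1)) -
      α * b * (1 - q ^ (n + 1)) * (1 - b * c * q ^ n) * (1 - b * d * q ^ n) * (1 - c * d * q ^ n) *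
        (b ^ n * awPoly q z b (α * q) c d n) := by
    rw [e1, e2, e3, Nat.sum_antidiagonal_succ', Nat.sum_antidiagonal_succ', add_mul, mul_add,
      sum_mul, mul_sum, mul_sum, add_sub_assoc, ← sum_sub_distrib]
    congr 1
    · linear_combination (qPoch (b * z) q (n + 1) * qPoch (b * z⁻¹) q (n + 1)) * s0
    · refine sum_congr rfl fun p hp => ?_
      have := s1 p.1 p.2 (by simpa using hp)
      linear_combination (qPoch (b * z) q p.1 * qPoch (b * z⁻¹) q p.1) * this
  linear_combination key

/-- The connection coefficient from parameters `(a, b, c, d)` to `(α, b, c, d)`, with `n = k + j`. -/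
noncomputable def awConn (q a b c d α : ℂ) (k j : ℕ) : ℂ :=
  qChoose q k j * qProd α a q j * qPoch (a * b * c * d / q * q ^ (k + j)) q k *
    (qPoch (b * c * q ^ k) q j * qPoch (b * d * q ^ k) q j * qPoch (c * d * q ^ k) q j) /
    (qPoch (α * b * c * d / q * q ^ k) q k * qPoch (α * b * c * d / q * q ^ (2 * k + 1)) q j)

theorem qProd_mul_succ (α a : ℂ) (j : ℕ) :
    qProd (α * q) a q (j + 1) = (α * q - a) * q ^ j * qProd α a q j := by
  rw [mul_assoc, ← qProd_mul, qProd, prod_range_succ', mul_comm]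
  simp only [qProd]
  congr 1
  · simp
  · exact prod_congr rfl fun s _ => by ring

/-- The contiguous relation rewrites each polynomial with parameter `α` of degree `k + 1` through
those with parameter `αq` of degrees `k + 1` and `k`; collecting equal degrees yields the connection
coefficients for `αq`. -/
theorem sum_awConn_shift (hq0 : q ≠ 0) (hq : ∀ n : ℕ, q ^ (n + 1) ≠ 1) {z : ℂ} (hz : z ≠ 0)
    (a b c d α : ℂ) (hα : ∀ j : ℕ, α * b * c * d * q ^ j ≠ 1) (n : ℕ) :
    ∑ p ∈ antidiagonal n, awConn q a b c d α p.1 p.2 * awPoly q z α b c d p.1 =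
      ∑ p ∈ antidiagonal n, awConn q a b c d (α * q) p.1 p.2 *
        awPoly q z (α * q) b c d p.1 := by
  obtain ⟨H, hH⟩ : ∃ H, H = α * b * c * d / q := ⟨_, rfl⟩
  have hHq : H * q = α * b * c * d := by rw [hH, div_mul_cancel₀ _ hq0]
  have hH' : α * q * b * c * d / q = H * q := by rw [hHq]; field_simp
  have hne : ∀ j : ℕ, 1 - H * q ^ (j + 1) ≠ 0 := fun j => by
    rw [pow_succ', ← mul_assoc, hHq]; exact sub_ne_zero.2 (hα j).symm
  have hne' : ∀ i j : ℕ, qPoch (H * q ^ (i + 1)) q j ≠ 0 := fun i j =>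
    qPoch_ne_zero (fun s => by
      rw [mul_assoc, ← pow_add, add_right_comm]; exact (sub_ne_zero.1 (hne _)).symm) j
  have h0 : ∀ β : ℂ, awPoly q z β b c d 0 = 1 := fun β => by
    simp [awPoly, qPoch_zero, qChoose_zero_left hq]
  cases n with
  | zero => simp [h0, awConn, qPoch_zero, qProd_zero]
  | succ n =>
    obtain ⟨G, hG⟩ : ∃ G, G = a * b * c * d / q := ⟨_, rfl⟩
    have hGH : α * G = a * H := by rw [hG, hH]; ring
    -- `X` collects the contributions of unchanged degree, `Y` those of degree lowered by one.
    -- Formally `X k j` is the coefficient for `α` times `(1 - Hq^k) / (1 - Hq^{2k})`, written in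
    -- cancelled form so that it also makes sense at `k = 0`, where `H = 1` is not excluded.
    set X : ℕ → ℕ → ℂ := fun k j => qChoose q k j * qProd α a q j *
      qPoch (G * q ^ (k + j)) q k *
      (qPoch (b * c * q ^ k) q j * qPoch (b * d * q ^ k) q j * qPoch (c * d * q ^ k) q j) /
      (qPoch (H * q ^ (k + 1)) q k * qPoch (H * q ^ (2 * k + 1)) q j) with hX
    set Y : ℕ → ℕ → ℂ := fun k j => -awConn q a b c d α (k + 1) j * (α * (1 - q ^ (k + 1)) *
      (1 - b * c * q ^ k) * (1 - b * d * q ^ k) * (1 - c * d * q ^ k)) /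
      (1 - H * q ^ (2 * k + 2)) with hY
    have t0 : ∀ j, awConn q a b c d α 0 j = X 0 j := fun j => by
      simp only [awConn, hX, ← hH, ← hG, qPoch_zero]
    have t1 : ∀ k j, awConn q a b c d α (k + 1) j * awPoly q z α b c d (k + 1) =
        X (k + 1) j * awPoly q z (α * q) b c d (k + 1) + Y k j * awPoly q z (α * q) b c d k := by
      intro k j
      have hA := awPoly_contiguous hq0 hq hz α b c d k
      rw [← hH] at hA
      have hx : awConn q a b c d α (k + 1) j * (1 - H * q ^ (k + 1)) =
          X (k + 1) j * (1 - H * q ^ (2 * k + 2)) := by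
        have hs := qPoch_mul_shift (q := q) H (k + 1) (k + 1)
        rw [show k + 1 + (k + 1) = 2 * k + 2 by ring] at hs
        have n1 := hne' k (k + 1)
        have n2 := hne' (k + 1) (k + 1)
        have n3 := hne' (2 * (k + 1)) j
        simp only [awConn, hX, ← hH, ← hG]
        rw [div_mul_eq_mul_div, div_mul_eq_mul_div,
          div_eq_div_iff (mul_ne_zero n1 n3) (mul_ne_zero n2 n3)]
        linear_combination (qChoose q (k + 1) j * qProd α a q j *
          qPoch (G * q ^ (k + 1 + j)) q (k + 1) *
          (qPoch (b * c * q ^ (k + 1)) q j * qPoch (b * d * q ^ (k + 1)) q j *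
          qPoch (c * d * q ^ (k + 1)) q j) * qPoch (H * q ^ (2 * (k + 1) + 1)) q j) * hs
      have n0 := hne (2 * k + 1)
      apply mul_right_cancel₀ n0
      simp only [hY, add_mul]
      rw [mul_right_comm _ (awPoly q z (α * q) b c d k), div_mul_cancel₀ _ n0]
      linear_combination awConn q a b c d α (k + 1) j * hA +
        awPoly q z (α * q) b c d (k + 1) * hx
    have t2 : ∀ k, awConn q a b c d (α * q) k 0 = X k 0 := fun k => by
      simp only [awConn, hX, hH', ← hG, qPoch_zero, qProd_zero, mul_assoc H q, ← pow_succ']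
    have t3 : ∀ k j, awConn q a b c d (α * q) k (j + 1) = X k (j + 1) + Y k j := by
      intro k j
      have hc : qChoose q (k + 1) j * (1 - q ^ (k + 1)) =
          qChoose q k (j + 1) * (1 - q ^ (j + 1)) := by
        rw [qChoose_succ_right hq, qChoose_comm, qChoose_succ_right hq, qChoose_comm, add_comm j]
      have hs := qPoch_mul_shift (q := q) H (2 * k + 1) (j + 1)
      have f1 := hne (2 * k)
      have f2 := hne (2 * k + 1)
      have f3 := hne (2 * k + 1 + j)
      have u0 := hne' k k
      have d0 := hne' (2 * k + 2) j
      have d1 := hne' (2 * k) (j + 1)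
      have e1 : qPoch (H * q ^ (2 * k + 1 + 1)) q (j + 1) =
          (1 - H * q ^ (2 * k + 2)) * qPoch (H * q ^ (2 * k + 3)) q j := by
        rw [qPoch_succ', mul_assoc _ (q ^ _), ← pow_succ]
      have e2 : qPoch (H * q ^ (k + 1)) q (k + 1) =
          qPoch (H * q ^ (k + 1)) q k * (1 - H * q ^ (2 * k + 1)) := by
        rw [qPoch_succ, mul_assoc _ (q ^ _), ← pow_add]; congr 4; ring
      have e3 : ∀ x : ℂ, qPoch (x * q ^ k) q (j + 1) =
          (1 - x * q ^ k) * qPoch (x * q ^ (k + 1)) q j := fun x => by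
        rw [qPoch_succ', mul_assoc _ (q ^ _), ← pow_succ]
      have e4 : qPoch (G * q ^ (k + 1 + j)) q (k + 1) =
          qPoch (G * q ^ (k + (j + 1))) q k * (1 - G * q ^ (2 * k + 1 + j)) := by
        rw [qPoch_succ, mul_assoc _ (q ^ _), ← pow_add]
        congr 4 <;> ring
      rw [e1, ← add_assoc] at hs
      have hX' : X k (j + 1) = qChoose q k (j + 1) * qProd α a q (j + 1) *
          qPoch (G * q ^ (k + (j + 1))) q k * (qPoch (b * c * q ^ k) q (j + 1) *
          qPoch (b * d * q ^ k) q (j + 1) * qPoch (c * d * q ^ k) q (j + 1)) *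
          (1 - H * q ^ (2 * k + 1 + j + 1)) / (qPoch (H * q ^ (k + 1)) q k *
          ((1 - H * q ^ (2 * k + 1)) * ((1 - H * q ^ (2 * k + 1 + 1)) *
            qPoch (H * q ^ (2 * k + 2 + 1)) q j))) := by
        simp only [hX]
        rw [hs, div_eq_div_iff (mul_ne_zero u0 d1)
          (mul_ne_zero u0 (mul_ne_zero d1 f3))]
        ring
      have p1 : 2 * (k + 1) + 1 = 2 * k + 2 + 1 := by ring
      rw [hX']
      simp only [awConn, hY, hH', ← hH, ← hG, qProd_mul_succ, p1, e4]
      rw [e2, mul_assoc H q, mul_assoc H q, ← pow_succ', ← pow_succ', e1, qProd_succ]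
      simp only [e3]
      -- After removal of common factors, `t3` reduces to this identity, which rests on `αG = aH`.
      have hp : (α * q - a) * q ^ j * (1 - H * q ^ (2 * k + 1)) =
          (α - a * q ^ j) * (1 - H * q ^ (2 * k + 1 + j + 1)) -
          α * (1 - q ^ (j + 1)) * (1 - G * q ^ (2 * k + 1 + j)) := by
        linear_combination (q ^ (2 * k + 1 + j) * (q ^ (j + 1) - 1)) * hGH
      simp only [Nat.add_assoc, Nat.reduceAdd] at *
      generalize 1 - H * q ^ (2 * k + 1) = g1 at *
      generalize 1 - H * q ^ (2 * k + 2) = g2 at *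
      generalize 1 - H * q ^ (2 * k + (1 + (j + 1))) = g3 at *
      generalize qPoch (H * q ^ (k + 1)) q k = u at *
      generalize qPoch (H * q ^ (2 * k + 3)) q j = v at *
      generalize qPoch (b * c * q ^ (k + 1)) q j = x₁
      generalize qPoch (b * d * q ^ (k + 1)) q j = x₂
      generalize qPoch (c * d * q ^ (k + 1)) q j = x₃
      generalize qPoch (G * q ^ (k + (j + 1))) q k = g at *
      generalize 1 - b * c * q ^ k = y₁
      generalize 1 - b * d * q ^ k = y₂
      generalize 1 - c * d * q ^ k = y₃
      generalize qProd α a q j = r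
      field_simp
      linear_combination (qChoose q k (j + 1) * r * g * x₁ * x₂ * x₃ * y₁ * y₂ * y₃) * hp +
        (α * (1 - G * q ^ (2 * k + (1 + j))) * r * g * x₁ * x₂ * x₃ * y₁ * y₂ * y₃) * hc
    rw [Nat.sum_antidiagonal_succ, Nat.sum_antidiagonal_succ']
    simp only [t0, t1, t2, t3, h0, sum_add_distrib, add_mul]
    have hs := Nat.sum_antidiagonal_succ (n := n)
      (f := fun p => X p.1 p.2 * awPoly q z (α * q) b c d p.1)
    rw [Nat.sum_antidiagonal_succ'] at hs
    simp only [h0] at hs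
    linear_combination -hs

/-- The factor `α^j (a/α; q)_j` is present as the polynomial `qProd α a q j`, and the denominators
equal `1` at `α = 0`. -/
theorem continuousAt_awConn (a b c d : ℂ) (k j : ℕ) :
    ContinuousAt (fun α => awConn q a b c d α k j) 0 := by
  have h : ∀ n, qPoch 0 q n = 1 := by simp [qPoch]
  refine ContinuousAt.div ?_ ?_ (by simp [h])
  · unfold qProd; fun_prop
  · unfold qPoch; fun_prop

/-- The connection relation: `p_n(x; a, b, c, d)` in terms of the `p_k(x; α, b, c, d)`. -/
theorem sum_awConn (hq0 : q ≠ 0) (hq1 : ‖q‖ < 1) {z : ℂ} (hz : z ≠ 0) (a b c d α : ℂ)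
    (ha : ∀ j : ℕ, a * b * c * d * q ^ j ≠ 1) (hα : ∀ j : ℕ, α * b * c * d * q ^ j ≠ 1) (n : ℕ) :
    ∑ p ∈ antidiagonal n, awConn q a b c d α p.1 p.2 * awPoly q z α b c d p.1 =
      awPoly q z a b c d n := by
  have hq : ∀ n : ℕ, q ^ (n + 1) ≠ 1 := fun n h => by
    have := pow_lt_one₀ (norm_nonneg q) hq1 n.succ_ne_zero
    rw [← norm_pow, h, norm_one] at this
    exact lt_irrefl _ this
  set E : ℂ → ℂ := fun α => ∑ p ∈ antidiagonal n, awConn q a b c d α p.1 p.2 *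
    awPoly q z α b c d p.1 with hE
  have shift : ∀ β : ℂ, (∀ j : ℕ, β * b * c * d * q ^ j ≠ 1) → E β = E 0 := by
    intro β hβ
    have h1 : ∀ m : ℕ, E (β * q ^ m) = E β := by
      intro m
      induction m with
      | zero => simp
      | succ m ih =>
        rw [← ih, pow_succ, ← mul_assoc]
        refine (sum_awConn_shift hq0 hq hz a b c d (β * q ^ m) (fun j => ?_) n).symm
        have := hβ (m + j)
        rw [pow_add] at this
        convert this using 1
        ring
    have h2 : Tendsto (fun m : ℕ => β * q ^ m) atTop (𝓝 0) := by
      simpa using (tendsto_pow_atTop_nhds_zero_of_norm_lt_one hq1).const_mul β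
    have h3 : ContinuousAt E 0 := by
      refine tendsto_finsetSum _ fun p _ => (continuousAt_awConn a b c d p.1 p.2).mul ?_
      exact (continuous_awPoly continuous_id continuous_const z c d p.1).continuousAt
    have h4 := h3.tendsto.comp h2
    simp only [Function.comp_def, h1] at h4
    exact tendsto_nhds_unique tendsto_const_nhds h4
  change E α = _
  -- Both `E α` and `E a` equal `E 0`; at `α = a` the factor `a - a` in `qProd a a` leaves only the
  -- term `j = 0`.
  rw [shift α hα, ← shift a ha, hE]
  have h0 : awConn q a b c d a n 0 = 1 := by
    simp only [awConn, qChoose_zero_right hq, qProd_zero, qPoch_zero, add_zero, mul_one, one_mul]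
    refine div_self ?_
    cases n with
    | zero => simp [qPoch_zero]
    | succ n =>
      refine qPoch_ne_zero (fun j => ?_) _
      have := ha (n + j)
      convert this using 1
      rw [pow_succ, pow_add]
      field_simp
  have hs : ∀ k j, awConn q a b c d a k (j + 1) = 0 := fun k j => by
    have : qProd a a q (j + 1) = 0 := by simp [qProd, prod_range_succ']
    simp [awConn, this]
  cases n with
  | zero => simp [h0]
  | succ n => simp [Nat.sum_antidiagonal_succ', h0, hs]
end

/-! ### Matching with the series of the statement -/

section
variable {q : ℂ}

theorem qPoch_mul_qPoch_neg (s q : ℂ) (n : ℕ) :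
    qPoch s q n * qPoch (-s) q n = ∏ j ∈ range n, (1 - s ^ 2 * q ^ (2 * j)) := by
  rw [qPoch, qPoch, ← prod_mul_distrib]
  refine prod_congr rfl fun j _ => ?_
  rw [mul_comm 2 j, pow_mul]; ring

/-- The pairs `±√` give `(x/q; q²)_n (x; q²)_n`, the even and odd factors of `(x/q; q)_{2n}`; the
branch of the root plays no role. -/
theorem qPoch_sqrt_mul (hq0 : q ≠ 0) (x : ℂ) (n : ℕ) :
    qPoch (Complex.sqrt (x / q)) q n * qPoch (-Complex.sqrt (x / q)) q n *
      (qPoch (Complex.sqrt x) q n * qPoch (-Complex.sqrt x) q n) =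
    qPoch (x / q) q n * qPoch (x / q * q ^ n) q n := by
  have hs : ∀ y : ℂ, Complex.sqrt y ^ 2 = y := fun y => by
    simp [Complex.sqrt]
  rw [qPoch_mul_qPoch_neg, qPoch_mul_qPoch_neg, hs, hs, ← qPoch_add, ← two_mul]
  induction n with
  | zero => simp [qPoch]
  | succ n ih =>
    rw [prod_range_succ, prod_range_succ, show 2 * (n + 1) = 2 * n + 1 + 1 by ring, qPoch_succ,
      qPoch_succ, ← ih, pow_succ]
    field_simp

theorem qPoch_zpow_neg (hq0 : q ≠ 0) (hq : ∀ n : ℕ, q ^ (n + 1) ≠ 1) (k l : ℕ) :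
    qPoch (q ^ (-((k + l : ℕ) : ℤ))) q k / qPoch q q k * q ^ k =
      qChoose q k l * ((-1) ^ k / (q ^ k.choose 2 * q ^ (k * l))) := by
  have h1 : qPoch (q ^ (-((k + l : ℕ) : ℤ))) q k = (q ^ (k + l))⁻¹ ^ k *
      ((-1) ^ k * q ^ k.choose 2 * qPoch (q * q ^ l) q k) := by
    rw [← qProd_reverse hq0 k (q ^ (k + l)) _ (by ring), ← qProd_mul, ← qProd_one, zpow_neg,
      zpow_natCast, mul_one, inv_mul_cancel₀ (pow_ne_zero _ hq0)]
  have h2 : qPoch q q (k + l) = qPoch q q l * qPoch (q * q ^ l) q k := by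
    rw [add_comm, qPoch_add]
  have n1 := qPoch_self_ne_zero hq k
  have n2 := qPoch_self_ne_zero hq l
  have tri : q ^ (k * k) = q ^ k.choose 2 * q ^ k.choose 2 * q ^ k := by
    rw [← pow_add, ← pow_add, choose_two_add_self]
  have h3 : (q ^ (k + l))⁻¹ ^ k = (q ^ k.choose 2 * q ^ k.choose 2 * q ^ k * q ^ (k * l))⁻¹ := by
    rw [← tri, inv_pow, ← pow_mul, add_mul, pow_add, mul_comm l]
  have a1 : q ^ k.choose 2 ≠ 0 := pow_ne_zero _ hq0
  rw [h1, qChoose, h2, h3]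
  field_simp

theorem qPochs_nil (q : ℂ) (n : ℕ) : qPochs [] q n = 1 := rfl

theorem qPochs_cons (a : ℂ) (as : List ℂ) (q : ℂ) (n : ℕ) :
    qPochs (a :: as) q n = qPoch a q n * qPochs as q n := by simp [qPochs]

theorem basicHypTerm_balanced {as bs : List ℂ} (h : as.length = bs.length + 1) (z : ℂ) (k : ℕ) :
    basicHypTerm as bs q z k = qPochs as q k / (qPoch q q k * qPochs bs q k) * z ^ k := by
  have : 1 + (bs.length : ℤ) - (as.length : ℤ) = 0 := by rw [h]; push_cast; ring
  rw [basicHypTerm, this, zpow_zero, mul_one, qPochs_cons]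

/-- Each factor `1 - 2aq^j cos φ + a²q^{2j}` depends on `cos φ` only. This allows `arccos (cos θ)`
to be replaced by an arbitrary real `θ`. -/
theorem qPoch_exp_mul_qPoch_exp_neg (a : ℂ) {φ θ : ℝ} (h : Real.cos φ = Real.cos θ) (k : ℕ) :
    qPoch (a * Complex.exp (Complex.I * φ)) q k * qPoch (a * Complex.exp (-(Complex.I * φ))) q k =
      qPoch (a * Complex.exp (Complex.I * θ)) q k *
        qPoch (a * Complex.exp (-(Complex.I * θ))) q k := by
  have hs : ∀ x : ℝ, Complex.exp (Complex.I * x) + Complex.exp (-(Complex.I * x)) =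
      2 * (Real.cos x : ℝ) := fun x => by
    rw [Complex.ofReal_cos, Complex.two_cos, mul_comm, neg_mul]
  have hm : ∀ x : ℝ, Complex.exp (Complex.I * x) * Complex.exp (-(Complex.I * x)) = 1 :=
    fun x => by rw [← Complex.exp_add, add_neg_cancel, Complex.exp_zero]
  have h1 := hs φ
  rw [h, ← hs θ] at h1
  have h2 := (hm φ).trans (hm θ).symm
  simp only [qPoch, ← prod_mul_distrib]
  refine prod_congr rfl fun j _ => ?_
  linear_combination (-(a * q ^ j)) * h1 + (a * q ^ j) ^ 2 * h2

theorem askeyWilson_eq_awPoly (hq0 : q ≠ 0) (hq : ∀ n : ℕ, q ^ (n + 1) ≠ 1) {a b c d : ℂ}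
    (ha : a ≠ 0) (hab : ∀ j : ℕ, a * b * q ^ j ≠ 1) (hac : ∀ j : ℕ, a * c * q ^ j ≠ 1)
    (had : ∀ j : ℕ, a * d * q ^ j ≠ 1) (θ : ℝ) (n : ℕ) :
    askeyWilson n (Real.cos θ) a b c d q =
      awPoly q (Complex.exp (Complex.I * θ)) a b c d n := by
  have hz : Complex.exp (Complex.I * θ) ≠ 0 := Complex.exp_ne_zero _
  have hF : a * b * c * d / q * q = a * b * c * d := div_mul_cancel₀ _ hq0
  have hcos : Real.cos (Real.arccos (Real.cos θ)) = Real.cos θ :=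
    Real.cos_arccos (Real.neg_one_le_cos θ) (Real.cos_le_one θ)
  have hsum := pow_mul_awPoly hq0 hq hz ha b c d _ hF n
  rw [askeyWilson, mul_assoc, inv_mul_eq_iff_eq_mul₀ (pow_ne_zero n ha), hsum, basicHyp,
    tsum_eq_sum (s := range (n + 1)), mul_sum, Nat.sum_antidiagonal_eq_sum_range_succ_mk]
  · refine sum_congr rfl fun k hk => ?_
    obtain ⟨l, rfl⟩ : ∃ l, n = k + l := ⟨n - k, by have := mem_range.1 hk; omega⟩
    have n1 := qPoch_ne_zero hab k
    have n2 := qPoch_ne_zero hac k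
    have n3 := qPoch_ne_zero had k
    have n4 := qPoch_self_ne_zero hq k
    have hw := qPoch_zpow_neg hq0 hq k l
    have he := qPoch_exp_mul_qPoch_exp_neg (q := q) a hcos k
    have hp : a * b * c * d * q ^ (((k + l : ℕ) : ℤ) - 1) = a * b * c * d / q * q ^ (k + l) := by
      rw [zpow_sub_one₀ hq0, zpow_natCast]; ring
    rw [Complex.exp_neg (Complex.I * θ)] at he
    rw [basicHypTerm_balanced rfl]
    simp only [qPochs_cons, qPochs_nil, mul_one, Nat.add_sub_cancel_left, hp, awCoeff, ← hw, ← he,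
      qPoch_add _ _ k l]
    field_simp
  · intro k hk
    have hk : n < k := by simpa using hk
    have : qPoch (q ^ (-(n : ℤ))) q k = 0 :=
      prod_eq_zero (mem_range.2 hk) (by
        rw [zpow_neg, zpow_natCast, inv_mul_cancel₀ (pow_ne_zero _ hq0), sub_self])
    rw [basicHypTerm, qPochs_cons, this]; simp

/-- The `t^n`-coefficient of the product of two `₂φ₁` series. -/
theorem sum_antidiagonal_basicHypTerm (hq : ∀ n : ℕ, q ^ (n + 1) ≠ 1) {z : ℂ} (hz : z ≠ 0)
    {a b c d : ℂ} (hab : ∀ j : ℕ, a * b * q ^ j ≠ 1) (hcd : ∀ j : ℕ, c * d * q ^ j ≠ 1)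
    (t : ℂ) (n : ℕ) :
    ∑ p ∈ antidiagonal n, basicHypTerm [a * z, b * z] [a * b] q (t * z⁻¹) p.1 *
      basicHypTerm [c * z⁻¹, d * z⁻¹] [c * d] q (t * z) p.2 =
    t ^ n / (qPoch q q n * qPoch (a * b) q n * qPoch (c * d) q n) * awPoly q z a b c d n := by
  rw [awPoly, mul_sum]
  refine sum_congr rfl fun p hp => ?_
  obtain ⟨i, j⟩ := p
  obtain rfl : i + j = n := by simpa using hp
  rw [basicHypTerm_balanced rfl, basicHypTerm_balanced rfl]
  have e1 := qPoch_add (a * b) q i j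
  have e2 := qPoch_add (c * d) q j i
  rw [add_comm j i] at e2
  have n1 := qPoch_ne_zero hab i
  have n2 := qPoch_ne_zero hcd j
  have n3 := qPoch_ne_zero hab (i + j)
  have n4 := qPoch_ne_zero hcd (i + j)
  have n5 := qPoch_self_ne_zero hq (i + j)
  have n6 := qPoch_self_ne_zero hq i
  have n7 := qPoch_self_ne_zero hq j
  rw [e1] at n3 ⊢
  rw [e2] at n4 ⊢
  have n8 := right_ne_zero_of_mul n3
  have n9 := right_ne_zero_of_mul n4
  simp only [qPochs_cons, qPochs_nil, mul_one, qChoose, mul_pow, pow_add, inv_pow]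
  field_simp

/-- The `(k, j)`-term of the double series, where `n = k + j`. -/
theorem awConn_term (hq0 : q ≠ 0) (hq : ∀ n : ℕ, q ^ (n + 1) ≠ 1) {a b c d α : ℂ} (hα : α ≠ 0)
    (hab : ∀ j : ℕ, a * b * q ^ j ≠ 1) (hcd : ∀ j : ℕ, c * d * q ^ j ≠ 1)
    (hG : ∀ j : ℕ, a * b * c * d / q * q ^ j ≠ 1) (hH : ∀ j : ℕ, α * b * c * d / q * q ^ j ≠ 1)
    (t : ℂ) (k j : ℕ) :
    t ^ k * qPochs [α * b * c * d / q, Complex.sqrt (a * b * c * d / q),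
        -Complex.sqrt (a * b * c * d / q), Complex.sqrt (a * b * c * d),
        -Complex.sqrt (a * b * c * d)] q k /
      qPochs [q, a * b, c * d, a * b * c * d / q, Complex.sqrt (α * b * c * d / q),
        -Complex.sqrt (α * b * c * d / q), Complex.sqrt (α * b * c * d),
        -Complex.sqrt (α * b * c * d)] q k *
      basicHypTerm
        [a / α, b * c * q ^ k, b * d * q ^ k, a * b * c * d * q ^ (2 * (k : ℤ) - 1)]
        [a * b * q ^ k, a * b * c * d * q ^ ((k : ℤ) - 1), α * b * c * d * q ^ (2 * k)]
        q (α * t) j =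
    t ^ (k + j) / (qPoch q q (k + j) * qPoch (a * b) q (k + j) * qPoch (c * d) q (k + j)) *
      awConn q a b c d α k j := by
  have p1 : a * b * c * d * q ^ (2 * (k : ℤ) - 1) = a * b * c * d / q * q ^ (2 * k) := by
    rw [zpow_sub_one₀ hq0, zpow_mul, zpow_ofNat, zpow_natCast, pow_mul]; ring
  have p2 : a * b * c * d * q ^ ((k : ℤ) - 1) = a * b * c * d / q * q ^ k := by
    rw [zpow_sub_one₀ hq0, zpow_natCast]; ring
  have p3 : α * b * c * d * q ^ (2 * k) = α * b * c * d / q * q ^ (2 * k + 1) := by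
    rw [pow_succ]; field_simp
  have s1 := qPoch_sqrt_mul hq0 (a * b * c * d) k
  have s2 := qPoch_sqrt_mul hq0 (α * b * c * d) k
  rw [basicHypTerm_balanced rfl, p1, p2, p3]
  simp only [qPochs_cons, qPochs_nil, mul_one]
  have r1 := qProd_eq_pow_mul (q := q) α (a / α) j
  rw [mul_div_cancel₀ _ hα] at r1
  -- Both sides are `(Gq^k; q)_{k+j}` with `G = abcd/q`, split in two ways.
  have r2 : qPoch (a * b * c * d / q * q ^ k) q j *
      qPoch (a * b * c * d / q * q ^ (k + j)) q k =
      qPoch (a * b * c * d / q * q ^ k) q k * qPoch (a * b * c * d / q * q ^ (2 * k)) q j := by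
    have h1 := qPoch_add (a * b * c * d / q * q ^ k) q j k
    have h2 := qPoch_add (a * b * c * d / q * q ^ k) q k j
    rw [mul_assoc _ (q ^ k), ← pow_add] at h1 h2
    rw [← h1, two_mul, ← h2, add_comm]
  have shift : ∀ x : ℂ, (∀ j : ℕ, x * q ^ j ≠ 1) → ∀ m n, qPoch (x * q ^ m) q n ≠ 0 :=
    fun x hx m n => qPoch_ne_zero (fun i => by rw [mul_assoc, ← pow_add]; exact hx _) n
  have n1 := qPoch_self_ne_zero hq k
  have n2 := qPoch_self_ne_zero hq j
  have n3 := qPoch_self_ne_zero hq (k + j)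
  have n4 := qPoch_ne_zero hab k
  have n5 := shift _ hab k j
  have n6 := qPoch_ne_zero hcd k
  have n7 := shift _ hcd k j
  have n8 := qPoch_ne_zero hG k
  have n9 := shift _ hG k j
  have n10 := qPoch_ne_zero hH k
  have n11 := shift _ hH k k
  have n12 := shift _ hH (2 * k + 1) j
  simp only [awConn, qChoose, r1, qPoch_add (a * b), qPoch_add (c * d), mul_pow, pow_add t]
  have e1 : qPoch (α * b * c * d / q) q k * (qPoch (Complex.sqrt (a * b * c * d / q)) q k *
      (qPoch (-Complex.sqrt (a * b * c * d / q)) q k * (qPoch (Complex.sqrt (a * b * c * d)) q k *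
      qPoch (-Complex.sqrt (a * b * c * d)) q k))) = qPoch (α * b * c * d / q) q k *
      (qPoch (a * b * c * d / q) q k * qPoch (a * b * c * d / q * q ^ k) q k) := by
    rw [← s1]; ring
  have e2 : qPoch q q k * (qPoch (a * b) q k * (qPoch (c * d) q k *
      (qPoch (a * b * c * d / q) q k * (qPoch (Complex.sqrt (α * b * c * d / q)) q k *
      (qPoch (-Complex.sqrt (α * b * c * d / q)) q k * (qPoch (Complex.sqrt (α * b * c * d)) q k *
      qPoch (-Complex.sqrt (α * b * c * d)) q k)))))) = qPoch q q k * (qPoch (a * b) q k *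
      (qPoch (c * d) q k * (qPoch (a * b * c * d / q) q k *
      (qPoch (α * b * c * d / q) q k * qPoch (α * b * c * d / q * q ^ k) q k)))) := by
    rw [← s2]; ring
  rw [e1, e2]
  generalize a * b * c * d / q = G at *
  generalize α * b * c * d / q = H at *
  generalize qPoch (G * q ^ (k + j)) q k = g1 at *
  generalize qPoch (G * q ^ k) q k = g2 at *
  generalize qPoch (G * q ^ k) q j = g3 at *
  generalize qPoch (G * q ^ (2 * k)) q j = g4 at *
  generalize qPoch (H * q ^ k) q k = h1 at *
  generalize qPoch (H * q ^ (2 * k + 1)) q j = h2 at *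
  generalize qPoch (a * b * q ^ k) q j = x1 at *
  generalize qPoch (b * c * q ^ k) q j = x2 at *
  generalize qPoch (b * d * q ^ k) q j = x3 at *
  generalize qPoch (c * d * q ^ k) q j = x4 at *
  generalize qPoch (a / α) q j = x5 at *
  field_simp
  linear_combination (-(t ^ k * t ^ j * x5 * x2 * x3)) * r2
end

/-! ### Uniform bounds and absolute convergence -/

section
variable {q : ℂ} {ι : Type*}

/-- A family of complex numbers is bounded. -/
def BddFamily (f : ι → ℂ) : Prop := ∃ M : ℝ, ∀ i, ‖f i‖ ≤ M

theorem BddFamily.mul {f g : ι → ℂ} (hf : BddFamily f) (hg : BddFamily g) :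
    BddFamily fun i => f i * g i := by
  obtain ⟨M, hM⟩ := hf
  obtain ⟨N, hN⟩ := hg
  exact ⟨M * N, fun i => (norm_mul_le _ _).trans
    (mul_le_mul (hM i) (hN i) (norm_nonneg _) ((norm_nonneg _).trans (hM i)))⟩

theorem BddFamily.of_norm_eq_one {f : ι → ℂ} (hf : ∀ i, ‖f i‖ = 1) : BddFamily f :=
  ⟨1, fun i => (hf i).le⟩

theorem prod_norm_le_exp (hq1 : ‖q‖ < 1) {u : ℕ → ℂ} {r : ℝ} (hr : 0 ≤ r)
    (hu : ∀ j, ‖u j‖ ≤ 1 + r * ‖q‖ ^ j) (n : ℕ) :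
    ‖∏ j ∈ range n, u j‖ ≤ Real.exp (r * (1 - ‖q‖)⁻¹) := by
  calc ‖∏ j ∈ range n, u j‖ = ∏ j ∈ range n, ‖u j‖ := norm_prod _ _
    _ ≤ ∏ j ∈ range n, Real.exp (r * ‖q‖ ^ j) := by
        refine prod_le_prod (fun j _ => norm_nonneg _) fun j _ => (hu j).trans ?_
        rw [add_comm]; exact Real.add_one_le_exp _
    _ = Real.exp (r * ∑ j ∈ range n, ‖q‖ ^ j) := by rw [← Real.exp_sum, mul_sum]
    _ ≤ _ := by
        refine Real.exp_le_exp.2 (mul_le_mul_of_nonneg_left ?_ hr)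
        rw [← tsum_geometric_of_lt_one (norm_nonneg q) hq1]
        exact (summable_geometric_of_lt_one (norm_nonneg q) hq1).sum_le_tsum _
          fun j _ => pow_nonneg (norm_nonneg q) j

theorem bddFamily_qPoch (hq1 : ‖q‖ < 1) {A : ι → ℂ} (hA : BddFamily A) (N : ι → ℕ) :
    BddFamily fun i => qPoch (A i) q (N i) := by
  obtain ⟨r, hr⟩ := hA
  refine ⟨Real.exp (r * (1 - ‖q‖)⁻¹), fun i => ?_⟩
  refine prod_norm_le_exp hq1 ((norm_nonneg _).trans (hr i)) (fun j => ?_) _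
  calc ‖1 - A i * q ^ j‖ ≤ ‖(1 : ℂ)‖ + ‖A i * q ^ j‖ := norm_sub_le _ _
    _ ≤ _ := by
      rw [norm_one, norm_mul, norm_pow]
      gcongr
      exact hr i

theorem bddFamily_mul_pow (hq1 : ‖q‖ < 1) (x : ℂ) (m : ι → ℕ) :
    BddFamily fun i => x * q ^ m i :=
  ⟨‖x‖, fun i => by
    rw [norm_mul, norm_pow]
    exact mul_le_of_le_one_right (norm_nonneg _) (pow_le_one₀ (norm_nonneg _) hq1.le)⟩

theorem bddFamily_inv_qPoch (hq1 : ‖q‖ < 1) {x : ℂ} (hx : ∀ j : ℕ, x * q ^ j ≠ 1)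
    (m N : ι → ℕ) : BddFamily fun i => (qPoch (x * q ^ m i) q (N i))⁻¹ := by
  have hlim : Tendsto (fun j : ℕ => ‖(1 - x * q ^ j)⁻¹‖) atTop (𝓝 1) := by
    have h1 : Tendsto (fun j : ℕ => 1 - x * q ^ j) atTop (𝓝 1) := by
      simpa using ((tendsto_pow_atTop_nhds_zero_of_norm_lt_one hq1).const_mul x).const_sub 1
    simpa using (h1.inv₀ one_ne_zero).norm
  obtain ⟨K, hK⟩ := hlim.bddAbove_range
  have hK : ∀ j : ℕ, ‖(1 - x * q ^ j)⁻¹‖ ≤ K := fun j => hK ⟨j, rfl⟩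
  have hK0 : 0 ≤ K := (norm_nonneg _).trans (hK 0)
  refine ⟨Real.exp (K * ‖x‖ * (1 - ‖q‖)⁻¹), fun i => ?_⟩
  change ‖(qPoch (x * q ^ m i) q (N i))⁻¹‖ ≤ _
  rw [qPoch, ← prod_inv_distrib]
  refine prod_norm_le_exp hq1 (by positivity) (fun j => ?_) _
  rw [mul_assoc x, ← pow_add]
  have h0 : 1 - x * q ^ (m i + j) ≠ 0 := sub_ne_zero.2 (hx _).symm
  -- The inverse factors are bounded by `K`, so each is `1 + O(|q|^j)` uniformly in the shift `m i`,
  -- and `prod_norm_le_exp` applies.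
  have h1 : (1 - x * q ^ (m i + j))⁻¹ = 1 + (1 - x * q ^ (m i + j))⁻¹ * (x * q ^ (m i + j)) := by
    field_simp; ring
  rw [h1]
  calc _ ≤ ‖(1 : ℂ)‖ + ‖(1 - x * q ^ (m i + j))⁻¹ * (x * q ^ (m i + j))‖ := norm_add_le _ _
    _ ≤ 1 + K * (‖x‖ * ‖q‖ ^ j) := by
      rw [norm_one, norm_mul, norm_mul, norm_pow]
      gcongr 1 + ?_ * (_ * ?_)
      · exact hK _
      · exact pow_le_pow_of_le_one (norm_nonneg _) hq1.le (Nat.le_add_left _ _)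
    _ = _ := by ring

theorem bddFamily_inv_qPoch_zero (hq1 : ‖q‖ < 1) {x : ℂ} (hx : ∀ j : ℕ, x * q ^ j ≠ 1)
    (N : ι → ℕ) : BddFamily fun i => (qPoch x q (N i))⁻¹ := by
  simpa using bddFamily_inv_qPoch hq1 hx (fun _ => 0) N

theorem bddFamily_const (x : ℂ) : BddFamily fun _ : ι => x := ⟨‖x‖, fun _ => le_rfl⟩

theorem summable_basicHypTerm (hq1 : ‖q‖ < 1) (hq : ∀ n : ℕ, q ^ (n + 1) ≠ 1) {as bs : List ℂ}
    (hl : as.length = bs.length + 1) (hbs : ∀ b ∈ bs, ∀ j : ℕ, b * q ^ j ≠ 1) {z : ℂ}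
    (hz : ‖z‖ < 1) : Summable (basicHypTerm as bs q z) := by
  have h1 : BddFamily fun k => qPochs as q k := by
    clear hl
    induction as with
    | nil => exact bddFamily_const 1
    | cons a as ih =>
      simp only [qPochs_cons]
      exact (bddFamily_qPoch hq1 (bddFamily_const a) _).mul ih
  have h2 : BddFamily fun k => (qPochs bs q k)⁻¹ := by
    clear hl
    induction bs with
    | nil => simpa [qPochs_nil] using bddFamily_const (ι := ℕ) 1
    | cons b bs ih =>
      simp only [qPochs_cons, mul_inv]
      exact (bddFamily_inv_qPoch_zero hq1 (hbs b (by simp)) _).mul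
        (ih fun b hb => hbs b (by simp [hb]))
  have h3 : BddFamily fun k => (qPoch q q k)⁻¹ :=
    bddFamily_inv_qPoch_zero hq1 (fun j => by simpa [pow_succ'] using hq j) _
  obtain ⟨M, hM⟩ := (h1.mul h2).mul h3
  refine Summable.of_norm_bounded ((summable_geometric_of_lt_one (norm_nonneg z) hz).mul_left M)
    fun k => ?_
  rw [basicHypTerm_balanced hl, norm_mul, norm_pow]
  gcongr
  refine le_trans (le_of_eq ?_) (hM k)
  rw [div_eq_mul_inv, mul_inv]; ring_nf

/-- On `|z| = 1` the defining sum has `n + 1` uniformly bounded terms. -/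
theorem exists_norm_awPoly_le (hq1 : ‖q‖ < 1) (hq : ∀ n : ℕ, q ^ (n + 1) ≠ 1) {z : ℂ}
    (hz : ‖z‖ = 1) (a b c d : ℂ) :
    ∃ M : ℝ, ∀ n, ‖awPoly q z a b c d n‖ ≤ M * (n + 1 : ℝ) := by
  have hqq : ∀ j : ℕ, q * q ^ j ≠ 1 := fun j => by simpa [pow_succ'] using hq j
  have hi : ∀ N : ℕ × ℕ → ℕ, BddFamily fun p => (qPoch q q (N p))⁻¹ :=
    bddFamily_inv_qPoch_zero hq1 hqq
  have hc : ∀ (x : ℂ) (N : ℕ × ℕ → ℕ), BddFamily fun p => qPoch x q (N p) := fun x =>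
    bddFamily_qPoch hq1 (bddFamily_const x)
  have hs : ∀ (x : ℂ) (m N : ℕ × ℕ → ℕ), BddFamily fun p => qPoch (x * q ^ m p) q (N p) :=
    fun x m => bddFamily_qPoch hq1 (bddFamily_mul_pow hq1 x m)
  have hch : BddFamily fun p : ℕ × ℕ => qChoose q p.1 p.2 := by
    simp only [qChoose, div_eq_mul_inv, mul_inv]
    exact (hc _ _).mul ((hi _).mul (hi _))
  obtain ⟨M, hM⟩ := (hch.mul ((((hc (a * z) Prod.fst).mul (hc (b * z) Prod.fst)).mul
    (hs (a * b) Prod.fst Prod.snd)).mul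
      (.of_norm_eq_one (f := fun p : ℕ × ℕ => z⁻¹ ^ p.1) fun p => by simp [hz]))).mul
    ((((hc (c * z⁻¹) Prod.snd).mul (hc (d * z⁻¹) Prod.snd)).mul
    (hs (c * d) Prod.snd Prod.fst)).mul
      (.of_norm_eq_one (f := fun p : ℕ × ℕ => z ^ p.2) fun p => by simp [hz]))
  refine ⟨M, fun n => ?_⟩
  refine (norm_sum_le_of_le _ fun p _ => hM p).trans (le_of_eq ?_)
  simp [mul_comm]

/-- Extracting `α^j` from `qProd α a q j` turns `t^{k+j}` into `t^k (αt)^j`; all other factors are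
bounded apart from the linear growth of the polynomial. The majorant is a constant times `(k +
1)|t|^k |αt|^j`. -/
theorem summable_awConn_mul_awPoly (hq1 : ‖q‖ < 1) (hq : ∀ n : ℕ, q ^ (n + 1) ≠ 1) {z : ℂ}
    (hz : ‖z‖ = 1) {a b c d α t : ℂ} (hα : α ≠ 0) (ht : ‖t‖ < 1) (hαt : ‖α * t‖ < 1)
    (hab : ∀ j : ℕ, a * b * q ^ j ≠ 1) (hcd : ∀ j : ℕ, c * d * q ^ j ≠ 1)
    (hH : ∀ j : ℕ, α * b * c * d / q * q ^ j ≠ 1) :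
    Summable fun p : ℕ × ℕ => t ^ (p.1 + p.2) / (qPoch q q (p.1 + p.2) *
      qPoch (a * b) q (p.1 + p.2) * qPoch (c * d) q (p.1 + p.2)) *
      (awConn q a b c d α p.1 p.2 * awPoly q z α b c d p.1) := by
  obtain ⟨M, hM⟩ := exists_norm_awPoly_le hq1 hq hz α b c d
  have hqq : ∀ j : ℕ, q * q ^ j ≠ 1 := fun j => by simpa [pow_succ'] using hq j
  have hi : ∀ {x : ℂ} (_ : ∀ j : ℕ, x * q ^ j ≠ 1) (N : ℕ × ℕ → ℕ),
    BddFamily fun p => (qPoch x q (N p))⁻¹ := fun hx => bddFamily_inv_qPoch_zero hq1 hx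
  have hc : ∀ (x : ℂ) (N : ℕ × ℕ → ℕ), BddFamily fun p => qPoch x q (N p) := fun x =>
    bddFamily_qPoch hq1 (bddFamily_const x)
  have hs : ∀ (x : ℂ) (m N : ℕ × ℕ → ℕ), BddFamily fun p => qPoch (x * q ^ m p) q (N p) :=
    fun x m => bddFamily_qPoch hq1 (bddFamily_mul_pow hq1 x m)
  have hch : BddFamily fun p : ℕ × ℕ => qChoose q p.1 p.2 := by
    simp only [qChoose, div_eq_mul_inv, mul_inv]
    exact (hc _ _).mul ((hi hqq _).mul (hi hqq _))
  obtain ⟨K, hK⟩ := ((((hi hqq fun p => p.1 + p.2).mul (hi hab fun p => p.1 + p.2)).mul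
    (hi hcd fun p => p.1 + p.2)).mul (((hch.mul (hc (a / α) Prod.snd)).mul
    (hs (a * b * c * d / q) (fun p => p.1 + p.2) Prod.fst)).mul
    (((hs (b * c) Prod.fst Prod.snd).mul (hs (b * d) Prod.fst Prod.snd)).mul
      (hs (c * d) Prod.fst Prod.snd)))).mul
    ((bddFamily_inv_qPoch hq1 hH Prod.fst Prod.fst).mul
      (bddFamily_inv_qPoch hq1 hH (fun p : ℕ × ℕ => 2 * p.1 + 1) Prod.snd))
  have hK0 : 0 ≤ K := (norm_nonneg _).trans (hK (0, 0))
  have g1 : Summable fun k : ℕ => (k + 1 : ℝ) * ‖t‖ ^ k := by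
    have h1 := summable_pow_mul_geometric_of_norm_lt_one 1 (r := ‖t‖) (by simpa using ht)
    have h2 := summable_geometric_of_lt_one (norm_nonneg t) ht
    simpa [add_mul] using h1.add h2
  have g2 := summable_geometric_of_lt_one (norm_nonneg _) hαt
  have g3 := ((g1.mul_of_nonneg g2 (fun k => by positivity) fun j => by positivity).mul_left
    (K * M))
  refine Summable.of_norm_bounded g3 fun p => ?_
  obtain ⟨k, j⟩ := p
  -- `B` is the product of all the bounded factors at `(k, j)`, its expression being read off from
  -- `hK`.
  obtain ⟨B, hB, hBK⟩ : ∃ B : ℂ, B = _ ∧ ‖B‖ ≤ K := ⟨_, rfl, hK (k, j)⟩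
  have r1 := qProd_eq_pow_mul (q := q) α (a / α) j
  rw [mul_div_cancel₀ _ hα] at r1
  calc _ = ‖B‖ * (‖t‖ ^ k * ‖α * t‖ ^ j * ‖awPoly q z α b c d k‖) := by
        rw [← norm_pow, ← norm_pow, ← norm_mul, ← norm_mul, ← norm_mul]
        congr 1
        rw [hB, awConn, r1, div_eq_mul_inv, div_eq_mul_inv]
        simp only [mul_inv, mul_pow, pow_add t]
        ring
    _ ≤ K * (‖t‖ ^ k * ‖α * t‖ ^ j * (M * (k + 1))) := by
        gcongr
        exact hM k
    _ = _ := by ring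

theorem hasSum_antidiagonal {f : ℕ × ℕ → ℂ} (hf : Summable f) {g : ℕ → ℂ} {S : ℂ}
    (hg : ∀ k, HasSum (fun j => f (k, j)) (g k))
    (hS : HasSum (fun n => ∑ p ∈ antidiagonal n, f p) S) : HasSum g S := by
  have h1 := hf.hasSum.prod_fiberwise hg
  have h2 : HasSum (fun x : Σ n : ℕ, antidiagonal n => f x.2) (∑' p, f p) :=
    (HasAntidiagonal.sigmaAntidiagonalEquivProd (A := ℕ)).hasSum_iff.2 hf.hasSum
  have h3 := h2.sigma fun n => hasSum_fintype _
  have h4 : HasSum (fun n => ∑ p ∈ antidiagonal n, f p) (∑' p, f p) := by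
    convert h3 using 2 with n
    exact (sum_finset_coe f _).symm
  rwa [hS.unique h4]
end

end

/-! ### The generating function -/

theorem theorem2
    (q : ℝ) (hq0 : 0 < q) (hq1 : q < 1)
    (a b c d : ℂ)
    -- `a, b, c, d` are real, or occur in complex conjugate pairs
    (hconj : Multiset.map (fun z : ℂ => conj z) {a, b, c, d} = ({a, b, c, d} : Multiset ℂ))
    (ha : ‖a‖ < 1) (hb : ‖b‖ < 1) (hc : ‖c‖ < 1) (hd : ‖d‖ < 1)
    (t : ℂ) (ht : ‖t‖ < (1 - q) ^ 3)
    (x θ : ℝ) (hx : x = Real.cos θ)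
    -- the free parameter
    (α : ℂ) (hα : α ≠ 0) (hαt : ‖α * t‖ < 1)
    -- no denominator vanishes
    (habcd : a * b * c * d ≠ q)
    (hαbcd : ∀ j : ℕ, α * b * c * d * (q : ℂ) ^ j ≠ q)
    (hαb : ∀ j : ℕ, α * b * (q : ℂ) ^ j ≠ 1)
    (hαc : ∀ j : ℕ, α * c * (q : ℂ) ^ j ≠ 1)
    (hαd : ∀ j : ℕ, α * d * (q : ℂ) ^ j ≠ 1) :
    -- the two `₂φ₁` series and all the `₄φ₃` series converge (absolutely)
    Summable (basicHypTerm [a * Complex.exp (Complex.I * θ), b * Complex.exp (Complex.I * θ)]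
      [a * b] q (t * Complex.exp (-(Complex.I * θ)))) ∧
    Summable (basicHypTerm
      [c * Complex.exp (-(Complex.I * θ)), d * Complex.exp (-(Complex.I * θ))]
      [c * d] q (t * Complex.exp (Complex.I * θ))) ∧
    (∀ n : ℕ, Summable (basicHypTerm
      [a / α, b * c * (q : ℂ) ^ n, b * d * (q : ℂ) ^ n,
        a * b * c * d * (q : ℂ) ^ (2 * (n : ℤ) - 1)]
      [a * b * (q : ℂ) ^ n, a * b * c * d * (q : ℂ) ^ ((n : ℤ) - 1),
        α * b * c * d * (q : ℂ) ^ (2 * n)]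
      q (α * t))) ∧
    -- the generating function
    HasSum
      (fun n : ℕ =>
        t ^ n *
          qPochs [α * b * c * d / q, Complex.sqrt (a * b * c * d / q),
            -Complex.sqrt (a * b * c * d / q), Complex.sqrt (a * b * c * d),
            -Complex.sqrt (a * b * c * d)] q n /
          qPochs [(q : ℂ), a * b, c * d, a * b * c * d / q, Complex.sqrt (α * b * c * d / q),
            -Complex.sqrt (α * b * c * d / q), Complex.sqrt (α * b * c * d),
            -Complex.sqrt (α * b * c * d)] q n *
          basicHyp
            [a / α, b * c * (q : ℂ) ^ n, b * d * (q : ℂ) ^ n,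
              a * b * c * d * (q : ℂ) ^ (2 * (n : ℤ) - 1)]
            [a * b * (q : ℂ) ^ n, a * b * c * d * (q : ℂ) ^ ((n : ℤ) - 1),
              α * b * c * d * (q : ℂ) ^ (2 * n)]
            q (α * t) *
          askeyWilson n x α b c d q)
      (basicHyp [a * Complex.exp (Complex.I * θ), b * Complex.exp (Complex.I * θ)]
          [a * b] q (t * Complex.exp (-(Complex.I * θ))) *
        basicHyp [c * Complex.exp (-(Complex.I * θ)), d * Complex.exp (-(Complex.I * θ))]
          [c * d] q (t * Complex.exp (Complex.I * θ))) := by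
  have hqn : ‖(q : ℂ)‖ = q := by simp [abs_of_pos hq0]
  have hq1' : ‖(q : ℂ)‖ < 1 := by rwa [hqn]
  have hq0' : (q : ℂ) ≠ 0 := by exact_mod_cast hq0.ne'
  have hqpow : ∀ j : ℕ, ‖(q : ℂ) ^ j‖ ≤ 1 := fun j => by
    rw [norm_pow]; exact pow_le_one₀ (norm_nonneg _) hq1'.le
  have small : ∀ y : ℂ, ‖y‖ < 1 → ∀ j : ℕ, y * (q : ℂ) ^ j ≠ 1 := fun y hy j h => by
    have h1 : ‖y * (q : ℂ) ^ j‖ < 1 := by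
      rw [norm_mul]
      exact (mul_le_of_le_one_right (norm_nonneg _) (hqpow j)).trans_lt hy
    rw [h, norm_one] at h1
    exact lt_irrefl _ h1
  have hqq : ∀ n : ℕ, (q : ℂ) ^ (n + 1) ≠ 1 := fun n => by
    rw [pow_succ']; exact small _ hq1' n
  have norm_mul_lt : ∀ {u v : ℂ}, ‖u‖ < 1 → ‖v‖ < 1 → ‖u * v‖ < 1 := fun hu hv => by
    rw [norm_mul]; exact mul_lt_one_of_nonneg_of_lt_one_left (norm_nonneg _) hu hv.le
  have hab := small _ (norm_mul_lt ha hb)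
  have hcd := small _ (norm_mul_lt hc hd)
  have hF := small _ (norm_mul_lt (norm_mul_lt (norm_mul_lt ha hb) hc) hd)
  have hG : ∀ j : ℕ, a * b * c * d / q * (q : ℂ) ^ j ≠ 1 := fun j h => by
    cases j with
    | zero => exact habcd (by rw [pow_zero, mul_one] at h; exact (div_eq_one_iff_eq hq0').1 h)
    | succ j =>
      refine hF j ?_
      rw [← h, pow_succ]; field_simp
  have hH : ∀ j : ℕ, α * b * c * d / q * (q : ℂ) ^ j ≠ 1 := fun j h => by
    refine hαbcd j ?_
    rwa [div_mul_eq_mul_div, div_eq_one_iff_eq hq0'] at h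
  have hD : ∀ j : ℕ, α * b * c * d * (q : ℂ) ^ j ≠ 1 := fun j h => by
    refine hH (j + 1) ?_
    rw [← h, pow_succ]; field_simp
  have ht1 : ‖t‖ < 1 := ht.trans_le (pow_le_one₀ (by linarith) (by linarith))
  set z := Complex.exp (Complex.I * θ) with hz
  have hz0 : z ≠ 0 := Complex.exp_ne_zero _
  have hz1 : ‖z‖ = 1 := by rw [hz, mul_comm]; exact Complex.norm_exp_ofReal_mul_I θ
  rw [Complex.exp_neg, ← hz]
  have shift : ∀ x : ℂ, (∀ j : ℕ, x * (q : ℂ) ^ j ≠ 1) → ∀ m j : ℕ,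
      x * (q : ℂ) ^ m * (q : ℂ) ^ j ≠ 1 := fun x hx m j => by
    rw [mul_assoc, ← pow_add]; exact hx _
  have S1 : Summable (basicHypTerm [a * z, b * z] [a * b] q (t * z⁻¹)) :=
    summable_basicHypTerm hq1' hqq rfl (by simpa using hab) (by simpa [hz1] using ht1)
  have S2 : Summable (basicHypTerm [c * z⁻¹, d * z⁻¹] [c * d] q (t * z)) :=
    summable_basicHypTerm hq1' hqq rfl (by simpa using hcd) (by simpa [hz1] using ht1)
  have S3 : ∀ n : ℕ, Summable (basicHypTerm
      [a / α, b * c * (q : ℂ) ^ n, b * d * (q : ℂ) ^ n,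
        a * b * c * d * (q : ℂ) ^ (2 * (n : ℤ) - 1)]
      [a * b * (q : ℂ) ^ n, a * b * c * d * (q : ℂ) ^ ((n : ℤ) - 1),
        α * b * c * d * (q : ℂ) ^ (2 * n)] q (α * t)) := fun n => by
    refine summable_basicHypTerm hq1' hqq rfl ?_ hαt
    have p : a * b * c * d * (q : ℂ) ^ ((n : ℤ) - 1) = a * b * c * d / q * (q : ℂ) ^ n := by
      rw [zpow_sub_one₀ hq0', zpow_natCast]; ring
    rw [p]
    simp only [List.forall_mem_cons]
    exact ⟨shift _ hab n, shift _ hG n, shift _ hD (2 * n), by simp⟩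
  refine ⟨S1, S2, S3, ?_⟩
  -- The double family over `(k, j)` is summed twice: the row at fixed `k` is the `k`-th term of the
  -- stated series, and the diagonal `k + j = n` collapses by the connection formula to the `n`-th
  -- term of the Cauchy product.
  refine hasSum_antidiagonal
    (summable_awConn_mul_awPoly hq1' hqq hz1 hα ht1 hαt hab hcd hH) (fun k => ?_) ?_
  · have h := ((S3 k).hasSum.mul_left (t ^ k *
      qPochs [α * b * c * d / q, Complex.sqrt (a * b * c * d / q),
        -Complex.sqrt (a * b * c * d / q), Complex.sqrt (a * b * c * d),
        -Complex.sqrt (a * b * c * d)] q k /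
      qPochs [(q : ℂ), a * b, c * d, a * b * c * d / q, Complex.sqrt (α * b * c * d / q),
        -Complex.sqrt (α * b * c * d / q), Complex.sqrt (α * b * c * d),
        -Complex.sqrt (α * b * c * d)] q k)).mul_right (askeyWilson k x α b c d q)
    refine (congrArg (HasSum · _) (funext fun j => ?_)).mpr h
    rw [awConn_term hq0' hqq hα hab hcd hG hH t k j, hx,
      askeyWilson_eq_awPoly hq0' hqq hα hαb hαc hαd, ← hz]
    ring
  · have hs : ∀ n : ℕ, ∑ p ∈ Finset.HasAntidiagonal.antidiagonal n, t ^ (p.1 + p.2) / (qPoch q q (p.1 + p.2) *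
        qPoch (a * b) q (p.1 + p.2) * qPoch (c * d) q (p.1 + p.2)) *
        (awConn q a b c d α p.1 p.2 * awPoly q z α b c d p.1) =
        ∑ p ∈ Finset.HasAntidiagonal.antidiagonal n, basicHypTerm [a * z, b * z] [a * b] q (t * z⁻¹) p.1 *
          basicHypTerm [c * z⁻¹, d * z⁻¹] [c * d] q (t * z) p.2 := fun n => by
      rw [sum_antidiagonal_basicHypTerm hqq hz0 hab hcd,
        ← sum_awConn hq0' hq1' hz0 a b c d α hF hD, Finset.mul_sum]
      refine Finset.sum_congr rfl fun p hp => ?_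
      rw [Finset.HasAntidiagonal.mem_antidiagonal.1 hp]
    rw [basicHyp, basicHyp,
      tsum_mul_tsum_eq_tsum_sum_antidiagonal_of_summable_norm S1.norm S2.norm]
    exact (congrArg (HasSum · _) (funext hs)).mpr
      (summable_norm_sum_mul_antidiagonal_of_summable_norm S1.norm S2.norm).of_norm.hasSum
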